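/- Let $f:\mathbb{C}\to\mathbb{C}$ be a transcendental entire function (that is, an entire function that is not a polynomial). For an entire function $g$ and $r>0$ write $M(r,g)=\max_{|z|=r}|g(z)|$, and let $f^n$ denote the $n$-th iterate of $f$. Then there exists $R=R(f)>0$ such that, for all real $c',c$ with $0<c'<1<c$ and all $n\in\mathbb{N}$, $$\log M(r^c,f^n)\ \ge\ c\,\log M(r,f^n)\qquad\text{for all } r\ge R,$$ and $$\log M(r^{c'},f^n)\ \le\ c'\,\log M(r,f^n)\qquad\text{for all } r\ge R^{1/c'}.$$ -/

import Mathlib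

/-- A transcendental entire function: holomorphic on the whole plane and not a polynomial function. -/
def IsTranscendentalEntire (f : ℂ → ℂ) : Prop :=
  Differentiable ℂ f ∧ ¬ ∃ p : Polynomial ℂ, ∀ z : ℂ, f z = p.eval z

/-- The maximum modulus `M(r, f)`, the maximum of `|f(z)|` over the circle `|z| = r`.
For continuous `f` and `r ≥ 0` the supremum is attained, see `isGreatest_maxModulus`. -/
noncomputable def maxModulus (r : ℝ) (f : ℂ → ℂ) : ℝ :=
  sSup ((fun z : ℂ => ‖f z‖) '' Metric.sphere (0 : ℂ) r)

theorem isGreatest_maxModulus {f : ℂ → ℂ} (hf : Continuous f) {r : ℝ} (hr : 0 ≤ r) :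
    IsGreatest ((fun z : ℂ => ‖f z‖) '' Metric.sphere (0 : ℂ) r) (maxModulus r f) :=
  ((isCompact_sphere (0 : ℂ) r).image hf.norm).isGreatest_sSup
    ((NormedSpace.sphere_nonempty.mpr hr).image _)

open Metric Set Filter Topology

/-! By Hadamard, `log M(e^t, g)` is convex in `t`. Superlinear growth in `t` therefore follows once
it at least doubles between `log S` and `2 log S` (`mul_log_maxModulus_le`). The point is to find
one `S` for all iterates. This goes by induction on `n`, using `M(S, h ∘ f) ≤ M(M(S, f), h)` and the
Pólya-type converse `M(M(S, f)^2, h) ≤ M(S^2, h ∘ f)`, with `h = f^n`. The converse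
(`maxModulus_le_maxModulus_comp`) comes from a weak Bloch theorem; it requires `M(S^2/4, f)` to
exceed a large multiple of `M(S, f)^2`, which is where transcendence enters. -/

theorem exists_norm_eq_maxModulus {g : ℂ → ℂ} (hg : Continuous g) {r : ℝ} (hr : 0 ≤ r) :
    ∃ z, ‖z‖ = r ∧ ‖g z‖ = maxModulus r g := by
  obtain ⟨z, hz, h⟩ := (isGreatest_maxModulus hg hr).1
  exact ⟨z, by simpa using hz, h⟩

/-- Maximum modulus principle, in terms of `maxModulus`. -/
theorem norm_le_maxModulus {g : ℂ → ℂ} (hg : Differentiable ℂ g) {r : ℝ} {z : ℂ}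
    (hz : ‖z‖ ≤ r) : ‖g z‖ ≤ maxModulus r g := by
  have hr : 0 ≤ r := (norm_nonneg z).trans hz
  have hs : ∀ w ∈ sphere (0 : ℂ) r, ‖g w‖ ≤ maxModulus r g := fun w hw =>
    (isGreatest_maxModulus hg.continuous hr).2 ⟨w, hw, rfl⟩
  rcases hz.eq_or_lt with h | h
  · exact hs z (by simpa using h)
  · have hr' : r ≠ 0 := ((norm_nonneg z).trans_lt h).ne'
    refine Complex.norm_le_of_forall_mem_frontier_norm_le (isBounded_ball (x := (0 : ℂ)) (r := r))
      hg.diffContOnCl (fun w hw => hs w ?_) (subset_closure (by simpa using h))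
    rwa [frontier_ball _ hr'] at hw

theorem maxModulus_nonneg {g : ℂ → ℂ} (hg : Differentiable ℂ g) {r : ℝ} (hr : 0 ≤ r) :
    0 ≤ maxModulus r g := by
  obtain ⟨z, -, h⟩ := exists_norm_eq_maxModulus hg.continuous hr
  exact h ▸ norm_nonneg _

theorem maxModulus_mono {g : ℂ → ℂ} (hg : Differentiable ℂ g) {r s : ℝ} (hr : 0 ≤ r)
    (hrs : r ≤ s) : maxModulus r g ≤ maxModulus s g := by
  obtain ⟨z, hz, h⟩ := exists_norm_eq_maxModulus hg.continuous hr
  exact h ▸ norm_le_maxModulus hg (hz.le.trans hrs)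

theorem maxModulus_id {r : ℝ} (hr : 0 ≤ r) : maxModulus r id = r := by
  obtain ⟨z, hz, h⟩ := exists_norm_eq_maxModulus continuous_id hr
  rw [← h, id, hz]

theorem maxModulus_comp_le {f h : ℂ → ℂ} (hf : Differentiable ℂ f) (hh : Differentiable ℂ h)
    {r : ℝ} (hr : 0 ≤ r) : maxModulus r (h ∘ f) ≤ maxModulus (maxModulus r f) h := by
  obtain ⟨z, hz, e⟩ := exists_norm_eq_maxModulus (hh.comp hf).continuous hr
  exact e ▸ norm_le_maxModulus hh (norm_le_maxModulus hf hz.le)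

/-! ### Convexity of the maximum modulus. -/

/-- Hadamard's three circles theorem. -/
theorem maxModulus_exp_le {g : ℂ → ℂ} (hg : Differentiable ℂ g) {a b t A C : ℝ} (hab : a < b)
    (hat : a ≤ t) (htb : t ≤ b) (hA : maxModulus (Real.exp a) g ≤ A)
    (hC : maxModulus (Real.exp b) g ≤ C) :
    maxModulus (Real.exp t) g ≤ A ^ (1 - (t - a) / (b - a)) * C ^ ((t - a) / (b - a)) := by
  obtain ⟨z, hz, h⟩ := exists_norm_eq_maxModulus hg.continuous (Real.exp_pos t).le
  have hz0 : z ≠ 0 := by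
    rw [← norm_pos_iff, hz]; exact Real.exp_pos t
  have hre : (Complex.log z).re = t := by rw [Complex.log_re, hz, Real.log_exp]
  -- The exponential turns circles into vertical lines, so three lines gives three circles.
  have key := Complex.HadamardThreeLines.norm_le_interp_of_mem_verticalClosedStrip'
    (f := g ∘ Complex.exp) (z := Complex.log z) (a := A) (b := C) hab
    (by simp only [Complex.HadamardThreeLines.verticalClosedStrip, mem_preimage, hre]
        exact ⟨hat, htb⟩)
    (hg.comp Complex.differentiable_exp).diffContOnCl
    (by
      refine ⟨maxModulus (Real.exp b) g, ?_⟩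
      rintro _ ⟨w, hw, rfl⟩
      refine norm_le_maxModulus hg ?_
      rw [Complex.norm_exp]
      exact Real.exp_le_exp.2 hw.2)
    (fun w hw => (norm_le_maxModulus hg (by rw [Complex.norm_exp, hw])).trans hA)
    (fun w hw => (norm_le_maxModulus hg (by rw [Complex.norm_exp, hw])).trans hC)
  rwa [hre, Function.comp_apply, Complex.exp_log hz0, h] at key

/-- Logarithmic form of Hadamard's three circles theorem. -/
theorem log_maxModulus_convex {g : ℂ → ℂ} (hg : Differentiable ℂ g) {a b t A : ℝ} (hab : a < b)
    (hat : a ≤ t) (htb : t ≤ b) (hA : maxModulus (Real.exp a) g ≤ A) (hA0 : 0 < A)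
    (ht : 0 < maxModulus (Real.exp t) g) :
    (b - a) * Real.log (maxModulus (Real.exp t) g) ≤
      (b - t) * Real.log A + (t - a) * Real.log (maxModulus (Real.exp b) g) := by
  have hC : 0 < maxModulus (Real.exp b) g :=
    ht.trans_le (maxModulus_mono hg (Real.exp_pos t).le (Real.exp_le_exp.2 htb))
  have h := Real.log_le_log ht (maxModulus_exp_le hg hab hat htb hA le_rfl)
  rw [Real.log_mul (Real.rpow_pos_of_pos hA0 _).ne' (Real.rpow_pos_of_pos hC _).ne',
    Real.log_rpow hA0, Real.log_rpow hC] at h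
  have hba : 0 < b - a := sub_pos.2 hab
  calc _ ≤ (b - a) * _ := mul_le_mul_of_nonneg_left h hba.le
    _ = _ := by field_simp; ring

/-! ### Bloch-type covering and omitted values. -/

/-- A quantitative form of the inverse function theorem for holomorphic functions. -/
theorem ball_subset_image_ball_of_norm_deriv_le {L : ℂ → ℂ} {z₀ : ℂ} {d : ℝ} (hd : 0 < d)
    (hL : DifferentiableOn ℂ L (ball z₀ d)) (h0 : deriv L z₀ ≠ 0)
    (hbd : ∀ z ∈ ball z₀ d, ‖deriv L z‖ ≤ 2 * ‖deriv L z₀‖) :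
    ball (L z₀) (‖deriv L z₀‖ * d / 24) ⊆ L '' ball z₀ d := by
  set a := ‖deriv L z₀‖ with ha
  have hdL : DifferentiableOn ℂ (deriv L) (ball z₀ d) := hL.deriv isOpen_ball
  have hsub : closedBall z₀ (d / 6) ⊆ ball z₀ d := closedBall_subset_ball (by linarith)
  have hderiv : ∀ z ∈ closedBall z₀ (d / 6), ‖deriv L z - deriv L z₀‖ ≤ a / 2 := by
    intro z hz
    -- Schwarz lemma for the derivative.
    have h1 := Complex.dist_le_div_mul_dist_of_mapsTo_ball (R₂ := 3 * a) hdL (fun w hw => by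
      rw [mem_closedBall, dist_eq_norm]
      linarith [norm_sub_le (deriv L w) (deriv L z₀), hbd w hw]) (hsub hz)
    rw [dist_eq_norm] at h1
    calc _ ≤ _ := h1
      _ ≤ 3 * a / d * (d / 6) := by gcongr; exact hz
      _ = a / 2 := by field_simp; ring
  have hlow : ∀ z ∈ sphere z₀ (d / 6), a * d / 12 ≤ ‖L z - L z₀‖ := by
    intro z hz
    have hd' : ∀ w ∈ closedBall z₀ (d / 6), HasDerivWithinAt (fun w => L w - deriv L z₀ * w)
        (deriv L w - deriv L z₀) (closedBall z₀ (d / 6)) w := fun w hw => by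
      have h1 := (hL.differentiableAt (isOpen_ball.mem_nhds (hsub hw))).hasDerivAt
      have h2 := h1.sub ((hasDerivAt_id w).const_mul (deriv L z₀))
      rw [mul_one] at h2
      exact h2.hasDerivWithinAt
    have h1 := (convex_closedBall z₀ (d / 6)).norm_image_sub_le_of_norm_hasDerivWithin_le hd' hderiv
      (mem_closedBall_self (by linarith)) (sphere_subset_closedBall hz)
    have hz' : ‖z - z₀‖ = d / 6 := by simpa [dist_eq_norm] using hz
    have h2 : ‖deriv L z₀ * (z - z₀)‖ = a * (d / 6) := by rw [norm_mul, hz']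
    have h3 : deriv L z₀ * (z - z₀) =
        (L z - L z₀) - ((L z - deriv L z₀ * z) - (L z₀ - deriv L z₀ * z₀)) := by ring
    rw [hz'] at h1
    have h4 := norm_sub_le (L z - L z₀) ((L z - deriv L z₀ * z) - (L z₀ - deriv L z₀ * z₀))
    rw [← h3, h2] at h4
    linarith
  have hne : ∃ᶠ z in 𝓝 z₀, L z ≠ L z₀ :=
    ((hL.differentiableAt (ball_mem_nhds z₀ hd)).hasDerivAt.eventually_ne
      h0).frequently.filter_mono nhdsWithin_le_nhds
  have hcl : DiffContOnCl ℂ L (ball z₀ (d / 6)) :=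
    (hL.mono (closure_ball_subset_closedBall.trans hsub)).diffContOnCl
  have h := hcl.ball_subset_image_closedBall (by linarith) hlow hne
  rw [show a * d / 12 / 2 = a * d / 24 by ring] at h
  exact h.trans (image_mono hsub)

/-- A weak form of Bloch's theorem: a holomorphic function on a disc which comes nowhere close to
covering a disc of radius `δ` has bounded oscillation on smaller discs. -/
theorem norm_sub_le_of_forall_exists_notMem_image {L : ℂ → ℂ} {r δ : ℝ} (hr : 0 < r)
    (hL : DifferentiableOn ℂ L (ball 0 r))
    (homit : ∀ w, ∃ v, dist v w ≤ δ ∧ v ∉ L '' ball 0 r) {z : ℂ} (hz : ‖z‖ ≤ r / 4) :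
    ‖L z - L 0‖ ≤ 48 * δ := by
  have hdL : DifferentiableOn ℂ (deriv L) (ball 0 r) := hL.deriv isOpen_ball
  have hsub : closedBall (0 : ℂ) (r / 2) ⊆ ball 0 r := closedBall_subset_ball (by linarith)
  -- Landau's trick: maximality of the weighted derivative at `z₀` makes `‖L'‖` at most double on
  -- the disc about `z₀` reaching half-way to the circle of radius `r / 2`.
  obtain ⟨z₀, hz₀, hmax⟩ := (isCompact_closedBall (0 : ℂ) (r / 2)).exists_isMaxOn
    (f := fun z => (r / 2 - ‖z‖) * ‖deriv L z‖) ⟨0, mem_closedBall_self (by linarith)⟩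
    ((continuous_const.sub continuous_norm).continuousOn.mul (hdL.continuousOn.mono hsub).norm)
  have hδ : 0 ≤ δ := by
    obtain ⟨v, hv, -⟩ := homit 0
    exact dist_nonneg.trans hv
  have hbound : (r / 2 - ‖z₀‖) * ‖deriv L z₀‖ ≤ 48 * δ := by
    have hz₀' : ‖z₀‖ ≤ r / 2 := by simpa using hz₀
    by_contra! hlt
    set a := ‖deriv L z₀‖ with ha
    have hpos : 0 < (r / 2 - ‖z₀‖) * a := by linarith
    have hz₀r : 0 < r / 2 - ‖z₀‖ := pos_of_mul_pos_left hpos (norm_nonneg _)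
    have ha0 : 0 < a := pos_of_mul_pos_right hpos hz₀r.le
    set d := (r / 2 - ‖z₀‖) / 2 with hd
    have hd0 : 0 < d := by positivity
    have hnorm : ∀ w ∈ ball z₀ d, ‖w‖ ≤ r / 2 - d := fun w hw => by
      have h1 : ‖w - z₀‖ < d := by simpa [dist_eq_norm] using hw
      have h2 := norm_add_le (w - z₀) z₀
      rw [sub_add_cancel] at h2
      linarith
    have hball : ball z₀ d ⊆ ball 0 r := fun w hw => by
      have := hnorm w hw
      simp only [mem_ball, dist_zero_right]
      linarith
    have hcov := ball_subset_image_ball_of_norm_deriv_le hd0 (hL.mono hball)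
      (norm_pos_iff.1 ha0) (fun w hw => by
        have h1 := hnorm w hw
        have h2 : (r / 2 - ‖w‖) * ‖deriv L w‖ ≤ (r / 2 - ‖z₀‖) * a :=
          hmax (by simp only [mem_closedBall, dist_zero_right]; linarith)
        have h3 : d * ‖deriv L w‖ ≤ (r / 2 - ‖w‖) * ‖deriv L w‖ := by
          gcongr; linarith
        refine le_of_mul_le_mul_left ?_ hd0
        calc _ ≤ _ := h3.trans h2
          _ = d * (2 * a) := by rw [hd]; ring)
    obtain ⟨v, hv, hvL⟩ := homit (L z₀)
    refine hvL (image_mono hball (hcov ?_))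
    rw [mem_ball]
    refine hv.trans_lt ?_
    rw [← ha, hd]
    linarith
  have hder : ∀ w ∈ closedBall (0 : ℂ) (r / 4), ‖deriv L w‖ ≤ 48 * δ / (r / 4) := fun w hw => by
    have hw' : ‖w‖ ≤ r / 4 := by simpa using hw
    have h1 : (r / 2 - ‖w‖) * ‖deriv L w‖ ≤ (r / 2 - ‖z₀‖) * ‖deriv L z₀‖ :=
      hmax (by simp only [mem_closedBall, dist_zero_right]; linarith)
    have h2 : r / 4 * ‖deriv L w‖ ≤ (r / 2 - ‖w‖) * ‖deriv L w‖ := by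
      gcongr; linarith
    rw [le_div_iff₀ (by linarith), mul_comm]
    linarith
  have hfin := (convex_closedBall (0 : ℂ) (r / 4)).norm_image_sub_le_of_norm_deriv_le
    (fun w hw => hL.differentiableAt (isOpen_ball.mem_nhds
      (closedBall_subset_ball (by linarith) hw))) hder
    (mem_closedBall_self (by linarith)) (by simpa using hz : z ∈ closedBall (0 : ℂ) (r / 4))
  rw [sub_zero] at hfin
  calc _ ≤ _ := hfin
    _ ≤ 48 * δ / (r / 4) * (r / 4) := by gcongr
    _ = _ := by field_simp

/-- A nonvanishing holomorphic function on a disc has a holomorphic logarithm. -/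
theorem exists_differentiableOn_exp_eq {g : ℂ → ℂ} {r : ℝ} (hr : 0 < r)
    (hg : DifferentiableOn ℂ g (ball 0 r)) (h0 : ∀ z ∈ ball (0 : ℂ) r, g z ≠ 0) :
    ∃ L : ℂ → ℂ, DifferentiableOn ℂ L (ball 0 r) ∧ ∀ z ∈ ball (0 : ℂ) r, Complex.exp (L z) = g z := by
  -- A primitive of `g' / g`, normalised at 0.
  obtain ⟨L, hL0, hL⟩ := ((hg.deriv isOpen_ball).div hg h0).isExactOn_ball.with_val_at 0
    (Complex.log (g 0))
  have hmem : (0 : ℂ) ∈ ball (0 : ℂ) r := mem_ball_self hr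
  refine ⟨L, fun z hz => (hL z hz).differentiableAt.differentiableWithinAt, fun z hz => ?_⟩
  have hd : ∀ w ∈ ball (0 : ℂ) r, HasDerivWithinAt (fun w => g w * Complex.exp (-L w)) 0
      (ball 0 r) w := fun w hw => by
    have h1 := (hg.differentiableAt (isOpen_ball.mem_nhds hw)).hasDerivAt.mul (hL w hw).neg.cexp
    refine (h1.congr_deriv ?_).hasDerivWithinAt
    have := h0 w hw
    simp only [Pi.div_apply]
    field_simp
    ring
  have h2 := (convex_ball (0 : ℂ) r).norm_image_sub_le_of_norm_hasDerivWithin_le (C := 0) hd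
    (by simp) hmem hz
  rw [zero_mul, norm_le_zero_iff, sub_eq_zero, hL0, Complex.exp_neg, Complex.exp_neg,
    Complex.exp_log (h0 0 hmem), mul_inv_cancel₀ (h0 0 hmem)] at h2
  exact (eq_of_mul_inv_eq_one h2).symm

/-- If `f` is large on the circle `|z| = r / 4`, then the maximum modulus of `h ∘ f` on `|z| = r`
dominates the maximum modulus of `h` on a large circle. -/
theorem maxModulus_le_maxModulus_comp {f h : ℂ → ℂ} (hf : Differentiable ℂ f)
    (hh : Differentiable ℂ h) {r ρ : ℝ} (hr : 0 < r) (hρ : 0 ≤ ρ)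
    (hlarge : Real.exp (48 * Real.pi) * (‖f 0‖ + ρ) + ρ < maxModulus (r / 4) f) :
    maxModulus ρ h ≤ maxModulus r (h ∘ f) := by
  by_contra! hlt
  obtain ⟨w₁, hw₁, hmax⟩ := exists_norm_eq_maxModulus hh.continuous hρ
  have homit : ∀ z ∈ ball (0 : ℂ) r, ∀ v, ‖h w₁‖ ≤ ‖h v‖ → f z ≠ v := by
    rintro z hz v hv rfl
    have h1 := norm_le_maxModulus (hh.comp hf) (z := z) (r := r) (by simpa using (mem_ball.1 hz).le)
    rw [Function.comp_apply] at h1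
    linarith
  obtain ⟨L, hL, hexp⟩ := exists_differentiableOn_exp_eq hr (hf.sub_const w₁).differentiableOn
    (fun z hz => sub_ne_zero.2 (homit z hz w₁ le_rfl))
  have hLomit : ∀ w, ∃ v, dist v w ≤ Real.pi ∧ v ∉ L '' ball 0 r := by
    intro w
    -- By the maximum principle, every circle about `w₁` carries a value that `f` omits on the disc.
    -- Hence `L` omits some point on each vertical line, and by periodicity of `exp` one within `π`
    -- of `w`.
    have hh' : Differentiable ℂ (fun z => h (z + w₁)) := hh.comp (differentiable_id.add_const w₁)
    obtain ⟨u, hu, hu'⟩ := exists_norm_eq_maxModulus hh'.continuous (Real.exp_pos w.re).le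
    have hle : ‖h w₁‖ ≤ ‖h (u + w₁)‖ := by
      rw [hu']
      simpa using norm_le_maxModulus hh' (z := 0) (r := Real.exp w.re) (by simp [Real.exp_nonneg])
    have hq : ‖u / Complex.exp w‖ = 1 := by
      rw [norm_div, hu, Complex.norm_exp, div_self (Real.exp_pos _).ne']
    have hq0 : u / Complex.exp w ≠ 0 := by rw [← norm_pos_iff, hq]; exact one_pos
    have hlog : Complex.log (u / Complex.exp w) = (u / Complex.exp w).arg * Complex.I := by
      rw [Complex.log, hq]; simp
    refine ⟨w + Complex.log (u / Complex.exp w), ?_, ?_⟩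
    · rw [dist_eq_norm, add_sub_cancel_left, hlog, norm_mul, Complex.norm_I, mul_one,
        Complex.norm_real]
      exact Complex.abs_arg_le_pi _
    · rintro ⟨z, hz, hzL⟩
      have h1 := hexp z hz
      rw [hzL, Complex.exp_add, Complex.exp_log hq0, mul_div_cancel₀ _ (Complex.exp_ne_zero w)] at h1
      exact homit z hz _ hle (by rw [h1]; ring)
  obtain ⟨z, hz, hzmax⟩ := exists_norm_eq_maxModulus hf.continuous (show 0 ≤ r / 4 by linarith)
  have hzr : z ∈ ball (0 : ℂ) r := by
    simp only [mem_ball, dist_zero_right]; linarith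
  have hosc := norm_sub_le_of_forall_exists_notMem_image hr hL hLomit hz.le
  have h1 : f z - w₁ = Complex.exp (L z - L 0) * (f 0 - w₁) := by
    rw [← hexp z hzr, ← hexp 0 (mem_ball_self hr), ← Complex.exp_add, sub_add_cancel]
  have h2 : ‖f z - w₁‖ ≤ Real.exp (48 * Real.pi) * (‖f 0‖ + ρ) := by
    rw [h1, norm_mul, Complex.norm_exp, ← hw₁]
    gcongr
    · exact (Complex.re_le_norm _).trans hosc
    · exact norm_sub_le _ _
  have h3 := norm_sub_norm_le (f z) w₁
  linarith

/-! ### Growth of transcendental functions. -/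

/-- A transcendental entire function grows faster than every polynomial. -/
theorem IsTranscendentalEntire.exists_forall_pow_le_maxModulus {f : ℂ → ℂ}
    (hf : IsTranscendentalEntire f) (k : ℕ) :
    ∃ R : ℝ, ∀ r, R ≤ r → r ^ k ≤ maxModulus r f := by
  by_contra! hcon
  refine hf.2 ⟨∑ n ∈ Finset.range (k + 1),
    Polynomial.monomial n ((n.factorial : ℂ)⁻¹ * iteratedDeriv n f 0), fun z => ?_⟩
  have hzero : ∀ n, k < n → iteratedDeriv n f 0 = 0 := by
    intro n hn
    rw [← norm_le_zero_iff]
    refine le_of_forall_pos_le_add fun ε hε => ?_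
    obtain ⟨r, hr, hlt⟩ := hcon (max 1 (n.factorial / ε))
    have hr1 : 1 ≤ r := (le_max_left _ _).trans hr
    have hr0 : 0 < r := by linarith
    -- Cauchy's estimate on an arbitrarily large circle where `M(r, f) < r ^ k`.
    have h1 := Complex.norm_iteratedDeriv_le_of_forall_mem_sphere_norm_le (c := 0) (f := f) n hr0
      hf.1.diffContOnCl (fun w hw => norm_le_maxModulus hf.1 (by simpa using (mem_sphere.1 hw).le))
    calc _ ≤ _ := h1
      _ ≤ n.factorial * r ^ k / r ^ (k + 1) := by
          have : 0 ≤ maxModulus r f := maxModulus_nonneg hf.1 hr0.le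
          have := pow_le_pow_right₀ hr1 (Nat.succ_le_of_lt hn)
          gcongr
      _ = n.factorial / r := by rw [pow_succ]; field_simp
      _ ≤ 0 + ε := by
          rw [zero_add, div_le_iff₀ hr0, mul_comm, ← div_le_iff₀ hε]
          exact (le_max_right _ _).trans hr
  have hs := Complex.taylorSeries_eq_of_entire hf.1 0 z
  rw [tsum_eq_sum (s := Finset.range (k + 1)) (fun n hn => by
    have hn' : k < n := by rw [Finset.mem_range] at hn; lia
    rw [hzero n hn', smul_zero, smul_zero])] at hs
  rw [← hs, Polynomial.eval_finsetSum]
  refine Finset.sum_congr rfl fun n _ => ?_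
  simp only [Polynomial.eval_monomial, sub_zero, smul_eq_mul]
  ring

/-- Convexity over the radii 16, `r`, `r^2/4`: on the log scale the whole interval exceeds twice its
left part by `log 4`. The surplus `log 4 * log M(r, f)` absorbs `D` and the constant `A`, as it
beats any multiple of `log r`. -/
theorem IsTranscendentalEntire.exists_forall_mul_sq_le_maxModulus {f : ℂ → ℂ}
    (hf : IsTranscendentalEntire f) {D : ℝ} (hD : 0 < D) :
    ∃ R : ℝ, ∀ r, R ≤ r → D * maxModulus r f ^ 2 ≤ maxModulus (r ^ 2 / 4) f := by
  set A := maxModulus 16 f + 1 with hA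
  have hA1 : 1 ≤ A := by linarith [maxModulus_nonneg hf.1 (show (0 : ℝ) ≤ 16 by norm_num)]
  have hα : 0 ≤ Real.log A := Real.log_nonneg hA1
  set a := Real.log 4 with ha
  have ha0 : 0 < a := Real.log_pos (by norm_num)
  obtain ⟨k, hk⟩ := exists_nat_ge ((2 * Real.log A + Real.log D) / a)
  rw [div_le_iff₀ ha0] at hk
  obtain ⟨R, hR⟩ := hf.exists_forall_pow_le_maxModulus k
  refine ⟨max R 64, fun r hr => ?_⟩
  have hr64 : 64 ≤ r := (le_max_right _ _).trans hr
  have hr0 : 0 < r := by linarith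
  have hpow := hR r ((le_max_left _ _).trans hr)
  have hM : 0 < maxModulus r f := lt_of_lt_of_le (by positivity) hpow
  have hexp : Real.exp (Real.log r) = r := Real.exp_log hr0
  have h16 : Real.exp (2 * a) = 16 := by
    rw [two_mul, Real.exp_add, ha, Real.exp_log (by norm_num)]; norm_num
  have hb : Real.exp (2 * Real.log r - a) = r ^ 2 / 4 := by
    rw [Real.exp_sub, two_mul, Real.exp_add, hexp, ha, Real.exp_log (by norm_num), sq]
  have hσ : 3 * a ≤ Real.log r := by
    have h := Real.log_le_log (by norm_num) hr64
    rwa [show (64 : ℝ) = 4 ^ 3 by norm_num, Real.log_pow] at h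
  have hMb : 0 < maxModulus (r ^ 2 / 4) f :=
    hM.trans_le (maxModulus_mono hf.1 hr0.le (by nlinarith))
  have hconv := log_maxModulus_convex hf.1 (a := 2 * a) (b := 2 * Real.log r - a)
    (t := Real.log r) (A := A) (by linarith) (by linarith) (by linarith)
    (by rw [h16]; linarith) (by linarith) (by rwa [hexp])
  rw [hexp, hb] at hconv
  have hφ := Real.log_le_log (by positivity) hpow
  rw [Real.log_pow] at hφ
  rw [← Real.log_le_log_iff (by positivity) hMb, Real.log_mul hD.ne' (by positivity), Real.log_pow]
  push_cast
  have hpos : 0 < Real.log r - 2 * a := by linarith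
  refine le_of_mul_le_mul_left ?_ hpos
  have h1 : (Real.log r - a) * Real.log A ≤ (Real.log r - 2 * a) * (2 * Real.log A) := by
    nlinarith
  have h2 : (Real.log r - 2 * a) * (2 * Real.log A + Real.log D) ≤ (Real.log r - 2 * a) * (k * a) :=
    mul_le_mul_of_nonneg_left hk hpos.le
  have h3 : a * (k * Real.log r) ≤ a * Real.log (maxModulus r f) :=
    mul_le_mul_of_nonneg_left hφ ha0.le
  have h4 : 0 ≤ (k : ℝ) * (a * a) := by positivity
  linarith

/-! ### Iterates with a uniform radius. -/

/-- Comparison of the maximum modulus of iterates with iterates of the maximum modulus. -/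
theorem IsTranscendentalEntire.exists_forall_maxModulus_iterate {f : ℂ → ℂ}
    (hf : IsTranscendentalEntire f) :
    ∃ S₀ : ℝ, 1 < S₀ ∧ ∀ n : ℕ, ∀ S, S₀ ≤ S → ∃ B, 1 < B ∧
      maxModulus S f^[n] ≤ B ∧ B ^ 2 ≤ maxModulus (S ^ 2) f^[n] := by
  set K := Real.exp (48 * Real.pi) with hK
  have hK0 : 0 < K := Real.exp_pos _
  obtain ⟨R₁, hR₁⟩ := hf.exists_forall_mul_sq_le_maxModulus (D := K * ‖f 0‖ + K + 2) (by positivity)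
  obtain ⟨R₂, hR₂⟩ := hf.exists_forall_pow_le_maxModulus 1
  refine ⟨max 2 (max R₁ R₂), lt_max_of_lt_left one_lt_two, fun n => ?_⟩
  induction n with
  | zero =>
    intro S hS
    have hS2 : 2 ≤ S := (le_max_left _ _).trans hS
    refine ⟨S, by linarith, ?_⟩
    rw [Function.iterate_zero, maxModulus_id (by linarith), maxModulus_id (by positivity)]
    exact ⟨le_rfl, le_rfl⟩
  | succ n ih =>
    intro S hS
    have hS2 : 2 ≤ S := (le_max_left _ _).trans hS
    have hS₁ : R₁ ≤ S := (le_max_left _ _).trans ((le_max_right _ _).trans hS)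
    have hS₂ : R₂ ≤ S := (le_max_right _ _).trans ((le_max_right _ _).trans hS)
    have hF : S ≤ maxModulus S f := by simpa using hR₂ S hS₂
    have hit : Differentiable ℂ f^[n] := hf.1.iterate n
    -- The induction hypothesis is used at radius `M(S, f) ≥ S`, and its `B` is kept.
    obtain ⟨B, hB, hup, hlow⟩ := ih _ (hS.trans hF)
    refine ⟨B, hB, (maxModulus_comp_le hf.1 hit (by linarith)).trans hup,
      hlow.trans (maxModulus_le_maxModulus_comp hf.1 hit (by positivity) (by positivity) ?_)⟩
    refine lt_of_lt_of_le ?_ (hR₁ S hS₁)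
    have hsq : 1 < maxModulus S f ^ 2 := by nlinarith
    have h1 : 0 ≤ K * ‖f 0‖ := by positivity
    nlinarith

/-- If the logarithm of the maximum modulus at least doubles from `S` to `S ^ 2`, convexity yields
superlinear growth beyond `S ^ 2`. -/
theorem mul_log_maxModulus_le {g : ℂ → ℂ} (hg : Differentiable ℂ g) {S B r c : ℝ} (hS : 1 < S)
    (hB : 1 < B) (hup : maxModulus S g ≤ B) (hlow : B ^ 2 ≤ maxModulus (S ^ 2) g)
    (hr : S ^ 2 ≤ r) (hc : 1 < c) :
    c * Real.log (maxModulus r g) ≤ Real.log (maxModulus (r ^ c) g) := by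
  have hS0 : 0 < S := by linarith
  have hr0 : 0 < r := lt_of_lt_of_le (by positivity) hr
  set s := Real.log S with hs
  set t := Real.log r with ht
  have hs0 : 0 < s := Real.log_pos hS
  have hst : 2 * s ≤ t := by
    have h := Real.log_le_log (by positivity) hr
    rwa [Real.log_pow] at h
  have hes : Real.exp s = S := Real.exp_log hS0
  have het : Real.exp t = r := Real.exp_log hr0
  have hes2 : Real.exp (2 * s) = S ^ 2 := by rw [two_mul, Real.exp_add, hes, sq]
  have hect : Real.exp (c * t) = r ^ c := by rw [Real.rpow_def_of_pos hr0, mul_comm]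
  have hM2 : 0 < maxModulus (S ^ 2) g := lt_of_lt_of_le (by positivity) hlow
  have hMr : 0 < maxModulus r g := hM2.trans_le (maxModulus_mono hg (by positivity) hr)
  have hct : t ≤ c * t := by nlinarith
  have h1 := log_maxModulus_convex hg (a := s) (b := t) (t := 2 * s) (A := B) (by linarith)
    (by linarith) hst (by rwa [hes]) (by linarith) (by rwa [hes2])
  have h2 := log_maxModulus_convex hg (a := s) (b := c * t) (t := t) (A := B) (by linarith)
    (by linarith) hct (by rwa [hes]) (by linarith) (by rwa [het])
  rw [hes2, het] at h1
  rw [het, hect] at h2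
  have h3 := Real.log_le_log (by positivity) hlow
  rw [Real.log_pow] at h3
  push_cast at h3
  -- The line through `(s, log B)` and `(t, log M(r, g))` meets the vertical axis at or below 0.
  have h4 : t * Real.log B ≤ s * Real.log (maxModulus r g) := by
    have := mul_le_mul_of_nonneg_left h3 (show 0 ≤ t - s by linarith)
    linarith
  have h5 := mul_le_mul_of_nonneg_left h4 (show 0 ≤ c - 1 by linarith)
  refine le_of_mul_le_mul_left ?_ (show 0 < t - s by linarith)
  linarith

theorem theorem2p2 (f : ℂ → ℂ) (hf : IsTranscendentalEntire f) :
    ∃ R : ℝ, 0 < R ∧ ∀ c' c : ℝ, 0 < c' → c' < 1 → 1 < c → ∀ n : ℕ,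
      (∀ r : ℝ, R ≤ r →
        c * Real.log (maxModulus r (f^[n])) ≤ Real.log (maxModulus (r ^ c) (f^[n]))) ∧
      (∀ r : ℝ, R ^ (1 / c') ≤ r →
        Real.log (maxModulus (r ^ c') (f^[n])) ≤ c' * Real.log (maxModulus r (f^[n]))) := by
  obtain ⟨S, hS, hiter⟩ := hf.exists_forall_maxModulus_iterate
  have hR : 0 < S ^ 2 := by positivity
  refine ⟨S ^ 2, hR, fun c' c hc'0 hc'1 hc n => ?_⟩
  obtain ⟨B, hB, hup, hlow⟩ := hiter n S le_rfl
  have key := fun (r c : ℝ) =>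
    mul_log_maxModulus_le (hf.1.iterate n) (r := r) (c := c) hS hB hup hlow
  refine ⟨fun r hr => key r c hr hc, fun r hr => ?_⟩
  have hr0 : 0 < r := lt_of_lt_of_le (Real.rpow_pos_of_pos hR _) hr
  have hρ : S ^ 2 ≤ r ^ c' := by
    have h := Real.rpow_le_rpow (Real.rpow_nonneg hR.le _) hr hc'0.le
    rwa [← Real.rpow_mul hR.le, one_div_mul_cancel hc'0.ne', Real.rpow_one] at h
  -- The second inequality is the first at radius `r ^ c'` with exponent `1 / c'`.
  have h := key (r ^ c') (1 / c') hρ (by rwa [lt_div_iff₀ hc'0, one_mul])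
  rw [← Real.rpow_mul hr0.le, mul_one_div_cancel hc'0.ne', Real.rpow_one, one_div_mul_eq_div,
    div_le_iff₀ hc'0] at h
  linarith
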